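/- Let $n\ge 1$ be an integer and let $\mathcal C^n$ be the family of all $n$-dimensional closed convex subsets of $\mathbb R^n$. For $f\in\mathbb R^n\setminus\mathbb Z^n$ and $\mathcal B\subseteq\mathcal C^n$ let $\mathcal B_f=\{B\in\mathcal B: f\in\operatorname{int}B\}$. For $B\in\mathcal C^n_f$ let $\psi_{B-f}(r)=\inf\{\lambda>0: r\in\lambda(B-f)\}$ be the gauge function of $B-f$. We call $\mathcal B$ *$f$-closed* if the family $\{\psi_{B-f}:B\in\mathcal B_f\}$ is closed with respect to pointwise convergence within the family $\{\psi_{C-f}:C\in\mathcal C^n_f\}$, that is, whenever a sequence of members of the first family converges pointwise to a member of the second, the limit belongs to the first. For $k\ge1$, $R=(r_1,\dots,r_k)\in\mathbb R^{n\times k}$ and $B\in\mathcal C^n$ put $$C_B(R,f)=\Bigl\{s\in\mathbb R^k_{\ge0}:\sum_{i=1}^k s_i\,\psi_{B-f}(r_i)\ge1\Bigr\}\ \text{ if } f\in\operatorname{int}B,\qquad C_B(R,f)=\mathbb R^k_{\ge0}\ \text{ otherwise,}$$ and put $C_{\mathcal B}(R,f)=\bigcap_{B\in\mathcal B}C_B(R,f)$,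 which is $\mathbb R^k_{\ge0}$ if $\mathcal B=\emptyset$. For $\mathcal B,\mathcal L\subseteq\mathcal C^n$ define, with values in $[0,\infty]$, $$\rho_f(\mathcal B,\mathcal L)=\inf\Bigl\{\alpha>0: C_{\mathcal B}(R,f)\subseteq\tfrac1\alpha C_{\mathcal L}(R,f)\text{ for all } k\ge1 \text{ and all } R\in\mathbb R^{n\times k}\Bigr\},$$ where $\inf\emptyset=\infty$, and $$\rho(\mathcal B,\mathcal L)=\sup\{\rho_f(\mathcal B,\mathcal L): f\in\mathbb R^n\setminus\mathbb Z^n\}.$$ **Theorem.** Let $\mathcal B\subseteq\mathcal C^n$. Let $\mathcal L\subseteq\mathcal C^n$ be a family of polyhedra, and suppose that there is an $m\in\mathbb N$ such that every $L\in\mathcal L$ has at most $m$ facets. Then the following hold. (a) Let $f\in\mathbb R^n\setminus\mathbb Z^n$ and suppose that $\mathcal B$ is $f$-closed. Then $\rho_f(\mathcal B,\mathcal L)<\infty$ if and only if there is a $\mu\in(0,1)$ such that for every $L\in\mathcal L_f$ some $B\in\mathcal B$ satisfies $B\supseteq\mu L+(1-\mu)f$. (b) Suppose that $\mathcal B$ is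 $f$-closed for all $f\in\mathbb R^n\setminus\mathbb Z^n$. Then $\rho(\mathcal B,\mathcal L)<\infty$ if and only if there is a $\mu\in(0,1)$ such that for every $f\in\mathbb R^n\setminus\mathbb Z^n$ and every $L\in\mathcal L_f$ some $B\in\mathcal B$ satisfies $B\supseteq\mu L+(1-\mu)f$. -/

import Mathlib

open Set Filter Topology
open scoped Pointwise ENNReal

namespace OneForAll

/-- The Euclidean space `ℝⁿ`. -/
abbrev E (n : ℕ) : Type := EuclideanSpace ℝ (Fin n)

/-- The lattice `ℤⁿ` as a subset of `ℝⁿ`. -/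
def intLattice (n : ℕ) : Set (E n) := {x | ∀ i, ∃ z : ℤ, x i = (z : ℝ)}

/-- The family `𝒞ⁿ` of all `n`-dimensional, closed, convex subsets of `ℝⁿ`
(`n`-dimensional: the affine hull is the whole space). -/
def closedConvexBodies (n : ℕ) : Set (Set (E n)) :=
  {B | IsClosed B ∧ Convex ℝ B ∧ affineSpan ℝ B = ⊤}

/-- The subfamily `ℬ_f` of all members of `ℬ` that contain `f` in the interior. -/
def familyAt {n : ℕ} (𝓑 : Set (Set (E n))) (f : E n) : Set (Set (E n)) :=
  {B | B ∈ 𝓑 ∧ f ∈ interior B}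

/-- The gauge function `ψ_{B - f}`, where
`ψ_M r = inf {t > 0 | r ∈ t M}` is Mathlib's `gauge`. -/
noncomputable def gaugeAt {n : ℕ} (f : E n) (B : Set (E n)) : E n → ℝ :=
  gauge ((fun x => x - f) '' B)

/-- The cut `C_B(R, f)`, where `R = (r₁, …, r_k)` is given by its columns. If `f` is not in the
interior of `B`, it is the whole nonnegative orthant. -/
def cut {n k : ℕ} (B : Set (E n)) (R : Fin k → E n) (f : E n) : Set (Fin k → ℝ) :=
  {s | (∀ i, 0 ≤ s i) ∧ (f ∈ interior B → 1 ≤ ∑ i, s i * gaugeAt f B (R i))}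

/-- The `ℬ`-closure `C_ℬ(R, f)`: the intersection of all cuts `C_B(R, f)` with `B ∈ ℬ`,
taken inside the nonnegative orthant (which it equals if `ℬ` is empty). -/
def familyClosure {n k : ℕ} (𝓑 : Set (Set (E n))) (R : Fin k → E n) (f : E n) :
    Set (Fin k → ℝ) :=
  {s | (∀ i, 0 ≤ s i) ∧ ∀ B ∈ 𝓑, s ∈ cut B R f}

/-- `C_ℬ(R, f) ⊆ (1/α) C_ℒ(R, f)` for every `R ∈ ⋃_{k ≥ 1} ℝ^{n × k}`. -/
def ApproximatesWithin {n : ℕ} (f : E n) (𝓑 𝓛 : Set (Set (E n))) (α : ℝ) : Prop :=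
  ∀ k : ℕ, 0 < k → ∀ R : Fin k → E n,
    familyClosure 𝓑 R f ⊆ (1 / α) • familyClosure 𝓛 R f

/-- `ρ_f(ℬ, ℒ)`, the infimum of all real `α > 0` with `C_ℬ(R, f) ⊆ (1/α) C_ℒ(R, f)` for all `R`;
it is `∞` if there is no such `α`. -/
noncomputable def rhoAt {n : ℕ} (f : E n) (𝓑 𝓛 : Set (Set (E n))) : ℝ≥0∞ :=
  sInf {a | ∃ α : ℝ, 0 < α ∧ ApproximatesWithin f 𝓑 𝓛 α ∧ a = ENNReal.ofReal α}

/-- `ρ(ℬ, ℒ)`, the supremum of `ρ_f(ℬ, ℒ)` over all `f ∈ ℝⁿ \ ℤⁿ`. -/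
noncomputable def rho {n : ℕ} (𝓑 𝓛 : Set (Set (E n))) : ℝ≥0∞ :=
  ⨆ f ∈ (intLattice n)ᶜ, rhoAt f 𝓑 𝓛

/-- `ℬ` is `f`-closed: the family `{ψ_{B - f} | B ∈ ℬ_f}` is closed with respect to pointwise
convergence within the family `{ψ_{C - f} | C ∈ 𝒞ⁿ_f}`. -/
def IsFClosed {n : ℕ} (f : E n) (𝓑 : Set (Set (E n))) : Prop :=
  ∀ B : ℕ → Set (E n), (∀ t, B t ∈ familyAt 𝓑 f) →
    ∀ C ∈ familyAt (closedConvexBodies n) f,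
      (∀ r, Tendsto (fun t => gaugeAt f (B t) r) atTop (𝓝 (gaugeAt f C r))) →
        gaugeAt f C ∈ gaugeAt f '' familyAt 𝓑 f

/-- A polyhedron: the solution set of a finite system of linear inequalities. -/
def IsPolyhedron {n : ℕ} (P : Set (E n)) : Prop :=
  ∃ (k : ℕ) (a : Fin k → E n) (b : Fin k → ℝ), P = {x | ∀ i, inner ℝ (a i) x ≤ b i}

/-- `F` is a facet of `P`: a nonempty face `P ∩ {x | u · x = c}`, with `u · x ≤ c` valid
for `P`, whose dimension is one less than that of `P`. -/
def IsFacet {n : ℕ} (P F : Set (E n)) : Prop :=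
  F.Nonempty ∧
  (∃ (u : E n) (c : ℝ), (∀ x ∈ P, inner ℝ u x ≤ c) ∧ F = {x ∈ P | inner ℝ u x = c}) ∧
  Module.finrank ℝ (vectorSpan ℝ F) + 1 = Module.finrank ℝ (vectorSpan ℝ P)

end OneForAll

open OneForAll

/-! Containment of `μL + (1-μ)f` in `B` says that the gauge of `B - f` is at most `μ⁻¹` times that
of `L - f`, so cuts compare with factor `μ⁻¹`; this is the easy direction
(`approximatesWithin_inv`).

Conversely, a finite `ρ_f` controls only finite weighted sums of gauges (`exists_sum_lt`), and a
single `B` must be extracted from them. Up to translation `L` is given by at most `m` inequalities,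
so at most `2 ^ m` points meet all its minimal faces, and a sublinear function vanishing on the
recession cone is bounded on `L - f` by its values at them (`exists_vertices`). Testing these points
together with more and more heavily weighted recession directions gives a sequence in `ℬ_f`. A
compactness argument and `f`-closedness turn it into one `B` whose gauge vanishes on the recession
cone and is bounded on `L - f` (`exists_gaugeAt_le`). The bound depends only on `α` and `m`, neither
on `L` nor on `f`, which gives (b) as well as (a). -/

namespace OneForAll

/-! ### Sublinear functions: Lipschitz bounds and compactness. -/

/-- Nonnegative sublinear functions on `ℝⁿ`. -/
structure IsSublinear {n : ℕ} (ψ : E n → ℝ) : Prop where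
  nonneg : ∀ x, 0 ≤ ψ x
  add_le : ∀ x y, ψ (x + y) ≤ ψ x + ψ y
  smul : ∀ (t : ℝ) (x : E n), 0 ≤ t → ψ (t • x) = t * ψ x

namespace IsSublinear

variable {n : ℕ} {ψ : E n → ℝ}

theorem zero (h : IsSublinear ψ) : ψ 0 = 0 := by
  simpa using h.smul 0 0 le_rfl

theorem sum_le (h : IsSublinear ψ) {ι : Type*} (s : Finset ι) (g : ι → E n) :
    ψ (∑ i ∈ s, g i) ≤ ∑ i ∈ s, ψ (g i) :=
  Finset.le_sum_of_subadditive ψ h.zero.le h.add_le s g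

theorem le_mul_norm (h : IsSublinear ψ) {M : ℝ}
    (hp : ∀ i, ψ (EuclideanSpace.single i 1) ≤ M)
    (hm : ∀ i, ψ (-EuclideanSpace.single i 1) ≤ M) (x : E n) : ψ x ≤ n * M * ‖x‖ := by
  have hx : x = ∑ i, x i • (EuclideanSpace.single i 1 : E n) := by
    have := (EuclideanSpace.basisFun (Fin n) ℝ).sum_repr x
    simpa using this.symm
  have hle : ∀ i, ψ (x i • (EuclideanSpace.single i 1 : E n)) ≤ ‖x‖ * M := by
    intro i
    have hM : 0 ≤ M := (h.nonneg _).trans (hp i)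
    have hxi : |x i| ≤ ‖x‖ := by simpa using PiLp.norm_apply_le x i
    rcases le_total 0 (x i) with h0 | h0
    · rw [h.smul _ _ h0]
      rw [abs_of_nonneg h0] at hxi
      exact mul_le_mul hxi (hp i) (h.nonneg _) (norm_nonneg _)
    · have : x i • (EuclideanSpace.single i 1 : E n) =
          (-x i) • (-(EuclideanSpace.single i 1 : E n)) := by simp
      rw [this, h.smul _ _ (by linarith)]
      rw [abs_of_nonpos h0] at hxi
      exact mul_le_mul hxi (hm i) (h.nonneg _) (norm_nonneg _)
  calc ψ x = ψ (∑ i, x i • (EuclideanSpace.single i 1 : E n)) := by rw [← hx]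
    _ ≤ ∑ i, ψ (x i • (EuclideanSpace.single i 1 : E n)) := h.sum_le _ _
    _ ≤ ∑ _i : Fin n, ‖x‖ * M := Finset.sum_le_sum fun i _ => hle i
    _ = n * M * ‖x‖ := by simp; ring

theorem abs_sub_le (h : IsSublinear ψ) {M : ℝ} (hM : ∀ x, ψ x ≤ M * ‖x‖) (x y : E n) :
    |ψ x - ψ y| ≤ M * ‖x - y‖ := by
  have h1 := h.add_le (x - y) y
  have h2 := h.add_le (y - x) x
  have h3 := hM (x - y)
  have h4 := hM (y - x)
  rw [norm_sub_rev] at h4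
  simp only [sub_add_cancel] at h1 h2
  rw [abs_le]
  constructor <;> linarith

theorem continuous_of_le (h : IsSublinear ψ) {M : ℝ} (hM : ∀ x, ψ x ≤ M * ‖x‖) :
    Continuous ψ := by
  refine (LipschitzWith.of_dist_le_mul (K := M.toNNReal) fun x y => ?_).continuous
  rw [Real.dist_eq, dist_eq_norm]
  exact (h.abs_sub_le hM x y).trans
    (mul_le_mul_of_nonneg_right (Real.le_coe_toNNReal M) (norm_nonneg _))

theorem of_tendsto {φ : ℕ → E n → ℝ} (h : ∀ t, IsSublinear (φ t))
    (hlim : ∀ x, Tendsto (fun t => φ t x) atTop (𝓝 (ψ x))) : IsSublinear ψ where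
  nonneg x := ge_of_tendsto' (hlim x) fun t => (h t).nonneg x
  add_le x y := le_of_tendsto_of_tendsto' (hlim (x + y)) ((hlim x).add (hlim y))
    fun t => (h t).add_le x y
  smul t x ht := tendsto_nhds_unique (hlim (t • x)) <| by
    simpa only [(h _).smul t x ht] using (hlim x).const_mul t

end IsSublinear

/-- Selection theorem: a uniformly bounded sequence of sublinear functions has a pointwise
convergent subsequence. -/
theorem exists_subseq_tendsto {n : ℕ} {φ : ℕ → E n → ℝ} (h : ∀ t, IsSublinear (φ t)) {M : ℝ}
    (hM : ∀ t x, φ t x ≤ M * ‖x‖) :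
    ∃ (k : ℕ → ℕ) (ψ : E n → ℝ), StrictMono k ∧
      ∀ x, Tendsto (fun t => φ (k t) x) atTop (𝓝 (ψ x)) := by
  -- Tychonoff: one subsequence converges at every point of a countable dense set.
  have hcomp : IsCompact (Set.univ.pi fun j : ℕ =>
      Set.Icc (0 : ℝ) (M * ‖TopologicalSpace.denseSeq (E n) j‖)) :=
    isCompact_univ_pi fun _ => isCompact_Icc
  obtain ⟨c, -, k, hk, hc⟩ := hcomp.tendsto_subseq
    (x := fun t j => φ t (TopologicalSpace.denseSeq (E n) j))
    (fun t j _ => ⟨(h t).nonneg _, hM t _⟩)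
  rw [tendsto_pi_nhds] at hc
  -- The common Lipschitz constant carries convergence from the dense set to every point.
  have hcau : ∀ x, ∃ l, Tendsto (fun t => φ (k t) x) atTop (𝓝 l) := by
    intro x
    apply cauchySeq_tendsto_of_complete
    rw [Metric.cauchySeq_iff]
    intro ε hε
    obtain ⟨j, hj⟩ : ∃ j, ‖x - TopologicalSpace.denseSeq (E n) j‖ < ε / (3 * (|M| + 1)) := by
      obtain ⟨j, hj⟩ := (TopologicalSpace.denseRange_denseSeq (E n)).exists_dist_lt x
        (show 0 < ε / (3 * (|M| + 1)) by positivity)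
      exact ⟨j, by rwa [dist_eq_norm] at hj⟩
    set q := TopologicalSpace.denseSeq (E n) j
    have hq : M * ‖x - q‖ < ε / 3 := by
      have h1 : M * ‖x - q‖ ≤ (|M| + 1) * ‖x - q‖ :=
        mul_le_mul_of_nonneg_right (by linarith [le_abs_self M]) (norm_nonneg _)
      have h2 : (|M| + 1) * ‖x - q‖ < (|M| + 1) * (ε / (3 * (|M| + 1))) :=
        mul_lt_mul_of_pos_left hj (by positivity)
      have h3 : (|M| + 1) * (ε / (3 * (|M| + 1))) = ε / 3 := by
        field_simp
      linarith
    obtain ⟨N, hN⟩ := Metric.cauchySeq_iff.1 (hc j).cauchySeq (ε / 3) (by positivity)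
    refine ⟨N, fun s hs t ht => ?_⟩
    have h1 := hN s hs t ht
    simp only [Real.dist_eq, Function.comp_apply] at h1 ⊢
    have h2 := ((h (k s)).abs_sub_le (hM _) x q).trans_lt hq
    have h3 := ((h (k t)).abs_sub_le (hM _) x q).trans_lt hq
    change |φ (k s) q - φ (k t) q| < ε / 3 at h1
    rw [abs_lt] at *
    constructor <;> linarith
  choose ψ hψ using hcau
  exact ⟨k, ψ, hk, hψ⟩

/-! ### Gauges of convex bodies as sublinear functions. -/

section Gauge

variable {n : ℕ} {f : E n} {B : Set (E n)}

theorem translate_mem_nhds_zero (hf : f ∈ interior B) : (fun x => x - f) '' B ∈ 𝓝 (0 : E n) := by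
  simpa using (Homeomorph.subRight f).isOpenMap.image_mem_nhds (mem_interior_iff_mem_nhds.1 hf)

theorem convex_translate (hB : Convex ℝ B) : Convex ℝ ((fun x => x - f) '' B) := by
  simpa [sub_eq_add_neg, add_comm] using hB.translate (-f)

theorem isSublinear_gaugeAt (hB : Convex ℝ B) (hf : f ∈ interior B) :
    IsSublinear (gaugeAt f B) where
  nonneg x := gauge_nonneg x
  add_le x y := gauge_add_le (convex_translate hB)
    (absorbent_nhds_zero (translate_mem_nhds_zero hf)) x y
  smul t x ht := by
    exact gauge_smul_of_nonneg (s := (fun x => x - f) '' B) ht x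

theorem add_mem_of_gaugeAt_lt_one (hB : Convex ℝ B) (hf : f ∈ interior B) {x : E n}
    (hx : gaugeAt f B x < 1) : f + x ∈ B := by
  have h0 := translate_mem_nhds_zero hf
  obtain ⟨y, hy, rfl⟩ := setOfPred_gauge_lt_one_subset_self (convex_translate hB)
    (mem_of_mem_nhds h0) (absorbent_nhds_zero h0) hx
  simpa using hy

theorem gaugeAt_le_one {x : E n} (hx : f + x ∈ B) : gaugeAt f B x ≤ 1 :=
  gauge_le_one_of_mem ⟨f + x, hx, by simp⟩

theorem gaugeAt_eq_zero {x : E n} (hx : ∀ t : ℝ, 0 < t → f + t • x ∈ B) : gaugeAt f B x = 0 := by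
  refine le_antisymm (le_of_forall_pos_le_add fun ε hε => ?_) (gauge_nonneg x)
  rw [zero_add]
  refine gauge_le_of_mem hε.le ⟨ε⁻¹ • x, ⟨f + ε⁻¹ • x, hx _ (inv_pos.2 hε), by simp⟩, ?_⟩
  exact smul_inv_smul₀ hε.ne' x

/-- A finite sublinear function is the gauge of a closed convex body. -/
theorem exists_gaugeAt_eq {ψ : E n → ℝ} (h : IsSublinear ψ) {M : ℝ}
    (hM : ∀ x, ψ x ≤ M * ‖x‖) (f : E n) :
    ∃ C ∈ familyAt (closedConvexBodies n) f, gaugeAt f C = ψ := by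
  have hcont := h.continuous_of_le hM
  have hc2 : Continuous fun x => ψ (x - f) := hcont.comp (continuous_id.sub continuous_const)
  have hint : f ∈ interior {x | ψ (x - f) ≤ 1} := by
    refine mem_interior.2 ⟨{x | ψ (x - f) < 1}, ofPred_subset_ofPred.2 fun _ => le_of_lt,
      isOpen_lt hc2 continuous_const, ?_⟩
    simp [h.zero]
  have hconv : Convex ℝ {x | ψ (x - f) ≤ 1} := by
    intro x hx y hy a b ha hb hab
    have e : a • x + b • y - f = a • (x - f) + b • (y - f) := by
      have : f = (a + b) • f := by rw [hab, one_smul]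
      nth_rw 1 [this]
      module
    have h1 := h.add_le (a • (x - f)) (b • (y - f))
    rw [h.smul _ _ ha, h.smul _ _ hb, ← e] at h1
    have h2 := mul_le_mul_of_nonneg_left (show ψ (x - f) ≤ 1 from hx) ha
    have h3 := mul_le_mul_of_nonneg_left (show ψ (y - f) ≤ 1 from hy) hb
    change ψ _ ≤ 1
    linarith
  refine ⟨{x | ψ (x - f) ≤ 1}, ⟨⟨isClosed_le hc2 continuous_const, hconv, ?_⟩, hint⟩, ?_⟩
  · rw [← hconv.interior_nonempty_iff_affineSpan_eq_top]
    exact ⟨f, hint⟩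
  · have hs := isSublinear_gaugeAt hconv hint
    have hmem : ∀ x, f + x ∈ {x | ψ (x - f) ≤ 1} ↔ ψ x ≤ 1 := by simp
    ext x
    -- The added `ε` allows rescaling even where the value is `0`, and makes the second gauge
    -- strictly less than `1`.
    refine le_antisymm (le_of_forall_pos_le_add fun ε hε => ?_)
      (le_of_forall_pos_le_add fun ε hε => ?_)
    · have hpos : 0 < ψ x + ε := add_pos_of_nonneg_of_pos (h.nonneg x) hε
      have h1 : gaugeAt f {x | ψ (x - f) ≤ 1} ((ψ x + ε)⁻¹ • x) ≤ 1 := by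
        refine gaugeAt_le_one ((hmem _).2 ?_)
        rw [h.smul _ _ (inv_pos.2 hpos).le, inv_mul_le_iff₀ hpos]
        linarith
      rw [hs.smul _ _ (inv_pos.2 hpos).le, inv_mul_le_iff₀ hpos] at h1
      linarith
    · set g := gaugeAt f {x | ψ (x - f) ≤ 1} x
      have hpos : 0 < g + ε := add_pos_of_nonneg_of_pos (hs.nonneg x) hε
      have h1 : gaugeAt f {x | ψ (x - f) ≤ 1} ((g + ε)⁻¹ • x) < 1 := by
        rw [hs.smul _ _ (inv_pos.2 hpos).le, inv_mul_lt_iff₀ hpos]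
        change g < _
        linarith
      have h2 := (hmem _).1 (add_mem_of_gaugeAt_lt_one hconv hint h1)
      rw [h.smul _ _ (inv_pos.2 hpos).le, inv_mul_le_iff₀ hpos] at h2
      linarith

end Gauge

/-! ### Minimal faces and facets of polyhedra. -/

section Polyhedra

variable {n : ℕ}

/-- The polyhedron `{x | a · x ≤ 1 for all a ∈ S}`. -/
def unitPolyhedron (S : Finset (E n)) : Set (E n) := {x | ∀ a ∈ S, inner ℝ a x ≤ 1}

open Classical in
/-- The number of inequalities of `unitPolyhedron S` that are not tight at `x`. -/
noncomputable def slackCount (S : Finset (E n)) (x : E n) : ℕ :=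
  (S.filter fun a => inner ℝ a x ≠ 1).card

/-- Ratio test: moving along `d` until the first inequality is hit makes a new one tight, while
those already tight stay so because `d` is orthogonal to their normals. -/
theorem exists_slackCount_lt {S : Finset (E n)} {x d : E n} (hx : x ∈ unitPolyhedron S)
    (hd : ∀ a ∈ S, inner ℝ a x = 1 → inner ℝ a d = 0) (hpos : ∃ a ∈ S, 0 < inner ℝ a d) :
    ∃ t : ℝ, 0 < t ∧ x + t • d ∈ unitPolyhedron S ∧ slackCount S (x + t • d) < slackCount S x := by
  classical
  obtain ⟨a₀, ha₀, hmin⟩ := (S.filter fun a => 0 < inner ℝ a d).exists_min_image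
    (fun a => (1 - inner ℝ a x) / inner ℝ a d)
    (by obtain ⟨a, ha, h⟩ := hpos; exact ⟨a, by simp [ha, h]⟩)
  rw [Finset.mem_filter] at ha₀
  obtain ⟨ha₀, h0⟩ := ha₀
  have hne : inner ℝ a₀ x ≠ 1 := fun h => h0.ne' (hd a₀ ha₀ h)
  have hlt : inner ℝ a₀ x < 1 := lt_of_le_of_ne (hx a₀ ha₀) hne
  set t := (1 - inner ℝ a₀ x) / inner ℝ a₀ d with ht
  have htpos : 0 < t := div_pos (by linarith) h0
  have hinner : ∀ a, inner ℝ a (x + t • d) = inner ℝ a x + t * inner ℝ a d := fun a => by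
    rw [inner_add_right, inner_smul_right]
  refine ⟨t, htpos, fun a ha => ?_, Finset.card_lt_card ?_⟩
  · rw [hinner]
    rcases le_or_gt (inner ℝ a d) 0 with h | h
    · have := hx a ha
      nlinarith
    · have := hmin a (by simp [ha, h])
      rw [le_div_iff₀ h] at this
      linarith
  · rw [Finset.ssubset_iff_of_subset]
    · refine ⟨a₀, by simp [ha₀, hne], ?_⟩
      have : inner ℝ a₀ (x + t • d) = 1 := by
        rw [hinner, ht]
        field_simp
        ring
      simp [this]
    · intro a ha
      rw [Finset.mem_filter] at ha ⊢
      refine ⟨ha.1, fun h => ha.2 ?_⟩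
      rw [hinner, hd a ha.1 h, h]
      simp

/-- A polyhedron with inequalities indexed by `S` has representatives `v I` of its minimal faces,
indexed by subsets `I` of `S`, that bound every sublinear function vanishing on the recession
cone. -/
theorem exists_vertices (S : Finset (E n)) :
    ∃ v : Finset (E n) → E n, (∀ I, v I ∈ unitPolyhedron S) ∧
      ∀ ψ : E n → ℝ, IsSublinear ψ → (∀ w, (∀ a ∈ S, inner ℝ a w ≤ 0) → ψ w = 0) →
        ∀ M : ℝ, (∀ I ∈ S.powerset, ψ (v I) ≤ M) → ∀ x ∈ unitPolyhedron S, ψ x ≤ M := by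
  classical
  -- If no point makes all of `I` tight, the default `0` still lies in the polyhedron.
  have hv : ∀ I : Finset (E n), ∃ v ∈ unitPolyhedron S,
      (∃ x ∈ unitPolyhedron S, ∀ a ∈ I, inner ℝ a x = 1) → ∀ a ∈ I, inner ℝ a v = 1 := by
    intro I
    by_cases h : ∃ x ∈ unitPolyhedron S, ∀ a ∈ I, inner ℝ a x = 1
    · obtain ⟨x, hx, hI⟩ := h
      exact ⟨x, hx, fun _ => hI⟩
    · exact ⟨0, fun a _ => by simp, fun h' => absurd h' h⟩
  choose v hvS hvI using hv
  refine ⟨v, hvS, fun ψ hψ hzero M hM x hx => ?_⟩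
  induction hk : slackCount S x using Nat.strong_induction_on generalizing x with
  | _ k ih =>
    subst hk
    by_cases hcase : ∀ d, (∀ a ∈ S, inner ℝ a x = 1 → inner ℝ a d = 0) →
        ∀ a ∈ S, inner ℝ a d = 0
    -- Here `x` lies on a minimal face, so `x - v I` is in the lineality space, where `ψ` vanishes.
    · set I := S.filter fun a => inner ℝ a x = 1
      have hI : ∀ a ∈ I, inner ℝ a (v I) = 1 :=
        hvI I ⟨x, hx, fun a ha => (Finset.mem_filter.1 ha).2⟩
      have hd := hcase (x - v I) fun a ha h => by
        rw [inner_sub_right, h, hI a (Finset.mem_filter.2 ⟨ha, h⟩), sub_self]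
      have h1 := hψ.add_le (v I) (x - v I)
      rw [hzero (x - v I) fun a ha => (hd a ha).le, add_sub_cancel] at h1
      have := hM I (Finset.mem_powerset.2 (Finset.filter_subset _ _))
      linarith
    · push Not at hcase
      obtain ⟨d, hd, hne⟩ : ∃ d, (∀ a ∈ S, inner ℝ a x = 1 → inner ℝ a d = 0) ∧
          ∃ a ∈ S, 0 < inner ℝ a d := by
        obtain ⟨d, hd, a, ha, hne⟩ := hcase
        rcases lt_or_gt_of_ne hne with h | h
        · refine ⟨-d, fun b hb hb1 => by rw [inner_neg_right, hd b hb hb1, neg_zero], a, ha, ?_⟩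
          rw [inner_neg_right]
          linarith
        · exact ⟨d, hd, a, ha, h⟩
      obtain ⟨t, ht, htS, htk⟩ := exists_slackCount_lt hx hd hne
      have h1 := ih _ htk _ htS rfl
      -- Either `x` is a convex combination of two points with fewer slack inequalities, or `-d` is
      -- a recession direction and `x` is reached from one such point at no cost in `ψ`.
      by_cases hneg : ∃ a ∈ S, 0 < inner ℝ a (-d)
      · obtain ⟨s, hs, hsS, hsk⟩ := exists_slackCount_lt hx
          (fun a ha h => by rw [inner_neg_right, hd a ha h, neg_zero]) hneg
        have h2 := ih _ hsk _ hsS rfl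
        have h3 := hψ.add_le (s • (x + t • d)) (t • (x + s • -d))
        have e : s • (x + t • d) + t • (x + s • -d) = (s + t) • x := by module
        rw [e, hψ.smul _ _ hs.le, hψ.smul _ _ ht.le, hψ.smul _ _ (by linarith)] at h3
        nlinarith
      · push Not at hneg
        have h2 := hψ.add_le (x + t • d) (t • -d)
        rw [hψ.smul _ _ ht.le, hzero _ hneg] at h2
        have e : x + t • d + t • -d = x := by module
        rw [e] at h2
        linarith

/-- A polyhedron with `f` in its interior is `f` plus a polyhedron with right-hand sides `1`. -/
theorem IsPolyhedron.exists_unitPolyhedron {L : Set (E n)} (hL : IsPolyhedron L) {f : E n}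
    (hf : f ∈ interior L) : ∃ S : Finset (E n), ∀ x, x ∈ L ↔ x - f ∈ unitPolyhedron S := by
  classical
  obtain ⟨k, a, b, rfl⟩ := hL
  have hfL := interior_subset hf
  have hstrict : ∀ i, a i ≠ 0 → 0 < b i - inner ℝ (a i) f := by
    intro i hi
    have hev : ∀ᶠ t : ℝ in 𝓝[>] 0, f + t • a i ∈ {x | ∀ i, inner ℝ (a i) x ≤ b i} := by
      have hc : Tendsto (fun t : ℝ => f + t • a i) (𝓝 0) (𝓝 f) := by
        have : Continuous fun t : ℝ => f + t • a i := by fun_prop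
        simpa using this.tendsto 0
      exact (hc.mono_left nhdsWithin_le_nhds) (mem_interior_iff_mem_nhds.1 hf)
    obtain ⟨t, ht, htpos⟩ := (hev.and self_mem_nhdsWithin).exists
    have h1 := ht i
    have h2 : 0 < inner ℝ (a i) (a i) := by
      rw [real_inner_self_eq_norm_sq]
      have := norm_pos_iff.2 hi
      positivity
    rw [inner_add_right, inner_smul_right] at h1
    have := mul_pos (show (0 : ℝ) < t from htpos) h2
    linarith
  -- When `a i = 0` the right-hand side may be `0`, but the scaled normal is then `0` and the
  -- inequality is trivial.
  refine ⟨Finset.univ.image fun i => (b i - inner ℝ (a i) f)⁻¹ • a i, fun x => ?_⟩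
  simp only [unitPolyhedron, Finset.mem_image, Finset.mem_univ, true_and, forall_exists_index,
    forall_apply_eq_imp_iff, mem_ofPred_eq]
  refine forall_congr' fun i => ?_
  by_cases hi : a i = 0
  · have := hfL i
    simp only [hi, inner_zero_left] at this
    simp [hi, this]
  · rw [real_inner_smul_left, inv_mul_le_iff₀ (hstrict i hi), inner_sub_right]
    constructor <;> intro h <;> linarith

/-- An inequality that cuts off a point satisfying all other inequalities defines a facet, and
this facet has a point at which all other inequalities are strict. -/
theorem isFacet_of_irredundant {L : Set (E n)} (hL : affineSpan ℝ L = ⊤) {f : E n}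
    {S : Finset (E n)} (hS : ∀ x, x ∈ L ↔ x - f ∈ unitPolyhedron S) {a : E n} (ha : a ∈ S)
    {y : E n} (hy : ∀ b ∈ S, b ≠ a → inner ℝ b y ≤ 1) (hya : 1 < inner ℝ a y) :
    IsFacet L {x ∈ L | inner ℝ a (x - f) = 1} ∧
      ∃ z ∈ L, inner ℝ a (z - f) = 1 ∧ ∀ b ∈ S, b ≠ a → inner ℝ b (z - f) < 1 := by
  have hya0 : 0 < inner ℝ a y := by linarith
  -- Shrinking `y` towards the origin puts it on the hyperplane of `a`; as `t < 1`, all other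
  -- inequalities become strict.
  set t := (inner ℝ a y)⁻¹ with ht
  have ht0 : 0 < t := inv_pos.2 hya0
  have ht1 : t < 1 := inv_lt_one_of_one_lt₀ hya
  have hza : inner ℝ a (t • y) = 1 := by
    rw [inner_smul_right, ht, inv_mul_cancel₀ hya0.ne']
  have hzb : ∀ b ∈ S, b ≠ a → inner ℝ b (t • y) < 1 := by
    intro b hb hba
    rw [inner_smul_right]
    have := hy b hb hba
    nlinarith
  have hzL : f + t • y ∈ L := by
    rw [hS, add_sub_cancel_left]
    intro b hb
    by_cases hba : b = a
    · rw [hba, hza]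
    · exact (hzb b hb hba).le
  have hane : a ≠ 0 := by
    rintro rfl
    simp at hya0
  refine ⟨⟨⟨f + t • y, hzL, by rwa [add_sub_cancel_left]⟩, ⟨a, 1 + inner ℝ a f, fun x hx => ?_, ?_⟩,
    ?_⟩, f + t • y, hzL, by rwa [add_sub_cancel_left], by simpa only [add_sub_cancel_left]⟩
  · have := (hS x).1 hx a ha
    rw [inner_sub_right] at this
    linarith
  · ext x
    simp only [mem_ofPred_eq, inner_sub_right, sub_eq_iff_eq_add]
  · have hspan : vectorSpan ℝ {x ∈ L | inner ℝ a (x - f) = 1} = (Submodule.span ℝ {a})ᗮ := by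
      apply le_antisymm
      · rw [vectorSpan_def, Submodule.span_le]
        rintro _ ⟨p, hp, q, hq, rfl⟩
        rw [SetLike.mem_coe, Submodule.mem_orthogonal_singleton_iff_inner_right]
        change inner ℝ a (p - q) = 0
        rw [← sub_sub_sub_cancel_right p q f, inner_sub_right, hp.2, hq.2, sub_self]
      -- The other inequalities are strict, so a small step in any direction orthogonal to `a` stays
      -- in the face.
      · intro d hd
        rw [Submodule.mem_orthogonal_singleton_iff_inner_right] at hd
        have hev : ∀ᶠ s : ℝ in 𝓝[>] 0, ∀ b ∈ S, b ≠ a → inner ℝ b (t • y + s • d) < 1 := by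
          refine nhdsWithin_le_nhds ?_
          refine (Finset.eventually_all S).2 fun b hb => ?_
          by_cases hba : b = a
          · exact Eventually.of_forall fun _ h => absurd hba h
          · have hc : Continuous fun s : ℝ => (inner ℝ b (t • y + s • d) : ℝ) := by fun_prop
            have := (hc.tendsto 0).eventually_lt_const (u := 1)
              (by simpa only [zero_smul, add_zero] using hzb b hb hba)
            exact this.mono fun s hs _ => hs
        obtain ⟨s, hs, hs0⟩ := (hev.and self_mem_nhdsWithin).exists
        have hs0 : 0 < s := hs0
        have hsa : inner ℝ a (t • y + s • d) = 1 := by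
          rw [inner_add_right, hza, inner_smul_right, hd, mul_zero, add_zero]
        have hp : f + (t • y + s • d) ∈ {x ∈ L | inner ℝ a (x - f) = 1} := by
          refine ⟨?_, by rwa [add_sub_cancel_left]⟩
          rw [hS, add_sub_cancel_left]
          intro b hb
          by_cases hba : b = a
          · rw [hba, hsa]
          · exact (hs b hb hba).le
        have hq : f + t • y ∈ {x ∈ L | inner ℝ a (x - f) = 1} :=
          ⟨hzL, by rwa [add_sub_cancel_left]⟩
        have h1 := vsub_mem_vectorSpan ℝ hp hq
        rw [vsub_eq_sub, add_sub_add_left_eq_sub, add_sub_cancel_left] at h1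
        exact (Submodule.smul_mem_iff _ hs0.ne').1 h1
    rw [hspan, AffineSubspace.vectorSpan_eq_top_of_affineSpan_eq_top ℝ _ _ hL, finrank_top,
      ← (Submodule.span ℝ {a}).finrank_add_finrank_orthogonal, finrank_span_singleton hane,
      add_comm]

/-- A full-dimensional polyhedron with at most `m` facets is described by at most `m`
inequalities. -/
theorem exists_unitPolyhedron_card_le {L : Set (E n)} (hL : affineSpan ℝ L = ⊤)
    (hP : IsPolyhedron L) {m : ℕ} (hm : {F | IsFacet L F}.encard ≤ m) {f : E n}
    (hf : f ∈ interior L) :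
    ∃ S : Finset (E n), S.card ≤ m ∧ ∀ x, x ∈ L ↔ x - f ∈ unitPolyhedron S := by
  classical
  have hex : ∃ k, ∃ S : Finset (E n), S.card = k ∧ ∀ x, x ∈ L ↔ x - f ∈ unitPolyhedron S := by
    obtain ⟨S, hS⟩ := hP.exists_unitPolyhedron hf
    exact ⟨_, S, rfl, hS⟩
  -- A description with the fewest inequalities has no redundant one, so its members inject into the
  -- facets.
  obtain ⟨S, hcard, hS⟩ := Nat.find_spec hex
  have hirr : ∀ a ∈ S, ∃ y, (∀ b ∈ S, b ≠ a → inner ℝ b y ≤ 1) ∧ 1 < inner ℝ a y := by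
    intro a ha
    by_contra! hcon
    refine Nat.find_min hex (m := (S.erase a).card)
      (hcard ▸ Finset.card_erase_lt_of_mem ha) ⟨S.erase a, rfl, fun x => ?_⟩
    rw [hS]
    refine ⟨fun h b hb => h b (Finset.mem_of_mem_erase hb), fun h => ?_⟩
    have h' : ∀ b ∈ S, b ≠ a → inner ℝ b (x - f) ≤ 1 := fun b hb hba =>
      h b (Finset.mem_erase.2 ⟨hba, hb⟩)
    intro b hb
    by_cases hba : b = a
    · exact hba ▸ hcon _ h'
    · exact h' b hb hba
  refine ⟨S, ?_, hS⟩
  have hfacet := fun a (ha : a ∈ S) =>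
    isFacet_of_irredundant hL hS ha (hirr a ha).choose_spec.1 (hirr a ha).choose_spec.2
  have hinj : InjOn (fun a => {x ∈ L | inner ℝ a (x - f) = 1}) (S : Set (E n)) := by
    intro a ha b hb hab
    by_contra hne
    obtain ⟨z, hz, hza, hzb⟩ := (hfacet a ha).2
    have hzF : z ∈ {x ∈ L | inner ℝ b (x - f) = 1} := by
      rw [← show {x ∈ L | inner ℝ a (x - f) = 1} = {x ∈ L | inner ℝ b (x - f) = 1} from hab]
      exact ⟨hz, hza⟩
    exact (hzb b hb (Ne.symm hne)).ne hzF.2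
  have h1 : ((S : Set (E n)).encard : ℕ∞) ≤ m := by
    rw [← hinj.encard_image]
    refine (encard_le_encard ?_).trans hm
    rintro _ ⟨a, ha, rfl⟩
    exact (hfacet a ha).1
  rw [encard_coe_eq_coe_finsetCard] at h1
  exact_mod_cast h1

end Polyhedra

/-! ### From closure inclusions to containment of bodies, and back. -/

section Approximation

variable {n : ℕ} {f : E n} {𝓑 𝓛 : Set (Set (E n))} {α : ℝ}

/-- Otherwise `s / (2αN)` lies in the `ℬ`-closure, hence `s / (2N)` in the `ℒ`-closure, although its
sum for `L` is at most `1/2`. The factor `2` supplies the strict contradiction. -/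
theorem ApproximatesWithin.exists_sum_lt (h : ApproximatesWithin f 𝓑 𝓛 α) (hα : 0 < α)
    {L : Set (E n)} (hL : L ∈ familyAt 𝓛 f) {ι : Type*} [Fintype ι] [Nonempty ι]
    {s : ι → ℝ} (hs : ∀ i, 0 ≤ s i) {R : ι → E n} {N : ℝ} (hN : 0 < N)
    (hle : ∑ i, s i * gaugeAt f L (R i) ≤ N) :
    ∃ B ∈ familyAt 𝓑 f, ∑ i, s i * gaugeAt f B (R i) < 2 * α * N := by
  by_contra! hcon
  have hpos : 0 < 2 * α * N := by positivity
  have hsum : ∀ (c : ℝ) (B : Set (E n)), ∑ i : Fin (Fintype.card ι),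
      c * s ((Fintype.equivFin ι).symm i) * gaugeAt f B (R ((Fintype.equivFin ι).symm i)) =
        c * ∑ i, s i * gaugeAt f B (R i) := by
    intro c B
    rw [(Fintype.equivFin ι).symm.sum_comp (fun i => c * s i * gaugeAt f B (R i)),
      Finset.mul_sum]
    simp only [mul_assoc]
  have hmem : (fun i => (2 * α * N)⁻¹ * s ((Fintype.equivFin ι).symm i)) ∈
      familyClosure 𝓑 (fun i => R ((Fintype.equivFin ι).symm i)) f := by
    have h0 : ∀ i, 0 ≤ (2 * α * N)⁻¹ * s ((Fintype.equivFin ι).symm i) :=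
      fun i => mul_nonneg (inv_pos.2 hpos).le (hs _)
    refine ⟨h0, fun B hB => ⟨h0, fun hfB => ?_⟩⟩
    rw [hsum, le_inv_mul_iff₀ hpos, mul_one]
    exact hcon B ⟨hB, hfB⟩
  obtain ⟨u, hu, hus⟩ := h _ Fintype.card_pos _ hmem
  have h1 := (hu.2 L hL.1).2 hL.2
  have hu' : ∀ i, u i = α * (2 * α * N)⁻¹ * s ((Fintype.equivFin ι).symm i) := by
    intro i
    have := congrFun hus i
    simp only [Pi.smul_apply, smul_eq_mul] at this
    rw [mul_assoc, ← this]
    field_simp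
  simp only [hu', hsum] at h1
  have h2 : α * (2 * α * N)⁻¹ = (2 * N)⁻¹ := by
    field_simp
  rw [h2, le_inv_mul_iff₀ (by positivity)] at h1
  linarith

/-- Each test constrains only finitely many directions; the body sought is a limit of bodies passing
ever larger tests. -/
theorem ApproximatesWithin.exists_gaugeAt_le (h : ApproximatesWithin f 𝓑 𝓛 α) (hα : 0 < α)
    (h𝓑 : 𝓑 ⊆ closedConvexBodies n) (hclosed : IsFClosed f 𝓑) {L : Set (E n)}
    (hL : L ∈ familyAt 𝓛 f) (hLC : L ∈ closedConvexBodies n) (hP : IsPolyhedron L) {m : ℕ}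
    (hm : {F | IsFacet L F}.encard ≤ m) :
    ∃ B ∈ familyAt 𝓑 f, ∀ x, f + x ∈ L → gaugeAt f B x ≤ 2 * α * (2 ^ m + 1) := by
  obtain ⟨S, hcard, hS⟩ := exists_unitPolyhedron_card_le hLC.2.2 hP hm hL.2
  have hS' : ∀ x, f + x ∈ L ↔ x ∈ unitPolyhedron S := fun x => by rw [hS, add_sub_cancel_left]
  obtain ⟨v, hv, hbound⟩ := exists_vertices S
  have hLs := isSublinear_gaugeAt hLC.2.1 hL.2
  let K : Set (E n) := {w | ∀ a ∈ S, inner ℝ a w ≤ 0}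
  have : Nonempty K := ⟨⟨0, fun a _ => by simp⟩⟩
  let w : ℕ → K := TopologicalSpace.denseSeq K
  have hLK : ∀ w ∈ K, gaugeAt f L w = 0 := by
    intro w hw
    refine gaugeAt_eq_zero fun t ht => (hS' _).2 fun a ha => ?_
    rw [inner_smul_right]
    have := mul_nonpos_of_nonneg_of_nonpos ht.le (hw a ha)
    linarith
  let e : Fin n → E n := fun i => EuclideanSpace.single i 1
  let D : ℝ := 1 + ∑ i, gaugeAt f L (e i) + ∑ i, gaugeAt f L (-e i)
  have hsum1 : 0 ≤ ∑ i, gaugeAt f L (e i) := Finset.sum_nonneg fun i _ => hLs.nonneg _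
  have hsum2 : 0 ≤ ∑ i, gaugeAt f L (-e i) := Finset.sum_nonneg fun i _ => hLs.nonneg _
  have hD : 0 < D := by positivity
  let C : ℝ := 2 * α * (2 ^ m + 1)
  have hC : 0 < C := by positivity
  have hstep : ∀ t : ℕ, ∃ B ∈ familyAt 𝓑 f, (∀ I ∈ S.powerset, gaugeAt f B (v I) ≤ C) ∧
      (∀ j < t, t * gaugeAt f B (w j) ≤ C) ∧ (∀ i, gaugeAt f B (e i) ≤ D * C) ∧
      ∀ i, gaugeAt f B (-e i) ≤ D * C := by
    intro t
    let ι := S.powerset ⊕ Fin t ⊕ Fin n ⊕ Fin n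
    have : Nonempty ι := ⟨Sum.inl ⟨∅, Finset.empty_mem_powerset S⟩⟩
    -- Recession directions have gauge `0` for `L`, so weight `t` is free and forces gauge at most
    -- `C / t` for `B`. The vectors `±e i` cost at most `1` in total and give the norm bound for
    -- compactness; `D` depends on `L` but does not enter `C`.
    let s : ι → ℝ := Sum.elim (fun _ => 1) (Sum.elim (fun _ => (t : ℝ)) fun _ => D⁻¹)
    let R : ι → E n := Sum.elim (fun I => v I)
      (Sum.elim (fun j => (w j : E n)) (Sum.elim e fun i => -e i))
    have hs : ∀ i, 0 ≤ s i := by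
      rintro (i | i | i | i)
      · exact zero_le_one
      · exact Nat.cast_nonneg t
      · exact (inv_pos.2 hD).le
      · exact (inv_pos.2 hD).le
    have hle : ∑ i, s i * gaugeAt f L (R i) ≤ 2 ^ m + 1 := by
      have h1 : ∑ I : S.powerset, gaugeAt f L (v I) ≤ 2 ^ m := by
        calc ∑ I : S.powerset, gaugeAt f L (v I) ≤ ∑ _I : S.powerset, (1 : ℝ) :=
              Finset.sum_le_sum fun I _ => gaugeAt_le_one ((hS' _).2 (hv I))
          _ = 2 ^ S.card := by simp
          _ ≤ 2 ^ m := pow_le_pow_right₀ one_le_two hcard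
      have h2 : ∀ j : Fin t, gaugeAt f L (w j) = 0 := fun j => hLK _ (w j).2
      have h3 : D⁻¹ * ∑ i, gaugeAt f L (e i) + D⁻¹ * ∑ i, gaugeAt f L (-e i) ≤ 1 := by
        rw [← mul_add, inv_mul_le_iff₀ hD]
        change _ ≤ (1 + _ + _) * (1 : ℝ)
        linarith
      simp only [ι, s, R, Fintype.sum_sum_type, Sum.elim_inl, Sum.elim_inr, one_mul, h2, mul_zero,
        Finset.sum_const_zero, zero_add, ← Finset.mul_sum]
      linarith
    obtain ⟨B, hB, hlt⟩ := h.exists_sum_lt hα hL hs (by positivity) hle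
    have hBs := isSublinear_gaugeAt (h𝓑 hB.1).2.1 hB.2
    have hterm : ∀ i, s i * gaugeAt f B (R i) ≤ C := fun i =>
      (Finset.single_le_sum (f := fun i => s i * gaugeAt f B (R i))
        (fun i _ => mul_nonneg (hs i) (hBs.nonneg _)) (Finset.mem_univ i)).trans hlt.le
    refine ⟨B, hB, fun I hI => ?_, fun j hj => ?_, fun i => ?_, fun i => ?_⟩
    · simpa [s, R] using hterm (Sum.inl ⟨I, hI⟩)
    · simpa [s, R] using hterm (Sum.inr (Sum.inl ⟨j, hj⟩))
    · exact (inv_mul_le_iff₀ hD).1 (hterm (Sum.inr (Sum.inr (Sum.inl i))))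
    · exact (inv_mul_le_iff₀ hD).1 (hterm (Sum.inr (Sum.inr (Sum.inr i))))
  choose B hB hBv hBw hBp hBm using hstep
  have hBs : ∀ t, IsSublinear (gaugeAt f (B t)) := fun t =>
    isSublinear_gaugeAt (h𝓑 (hB t).1).2.1 (hB t).2
  have hnorm : ∀ t x, gaugeAt f (B t) x ≤ n * (D * C) * ‖x‖ := fun t =>
    (hBs t).le_mul_norm (hBp t) (hBm t)
  obtain ⟨k, ψ, hk, hψ⟩ := exists_subseq_tendsto hBs hnorm
  have hψs : IsSublinear ψ := IsSublinear.of_tendsto (fun t => hBs (k t)) hψ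
  have hψn : ∀ x, ψ x ≤ n * (D * C) * ‖x‖ := fun x => le_of_tendsto' (hψ x) fun t => hnorm _ x
  obtain ⟨A, hA, hAψ⟩ := exists_gaugeAt_eq hψs hψn f
  obtain ⟨B₀, hB₀, hB₀A⟩ := hclosed (fun t => B (k t)) (fun t => hB _) A hA
    (by rw [hAψ]; exact hψ)
  refine ⟨B₀, hB₀, fun x hx => ?_⟩
  rw [hB₀A, hAψ]
  refine hbound ψ hψs ?_ C (fun I hI => le_of_tendsto' (hψ _) fun t => hBv _ I hI) x
    ((hS' x).1 hx)
  -- Once `k t > j`, the gauge at `w j` is at most `C / k t`, which tends to `0`; density and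
  -- continuity then cover the whole cone.
  have hzero : ∀ j, ψ (w j) = 0 := by
    intro j
    refine le_antisymm (le_of_tendsto_of_tendsto (hψ _)
      ((tendsto_const_div_atTop_nhds_zero_nat C).comp hk.tendsto_atTop) ?_) (hψs.nonneg _)
    filter_upwards [hk.tendsto_atTop.eventually_gt_atTop j] with t ht
    have h0 : (0 : ℝ) < k t := by exact_mod_cast (Nat.zero_le j).trans_lt ht
    rw [Function.comp_apply, le_div_iff₀ h0, mul_comm]
    exact hBw _ j ht
  have hall := (TopologicalSpace.denseRange_denseSeq K).equalizer
    (g := fun x : K => ψ x) (h := fun _ => 0)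
    ((hψs.continuous_of_le hψn).comp continuous_subtype_val) continuous_const
    (funext hzero)
  exact fun x hx => congrFun hall ⟨x, hx⟩

theorem approximatesWithin_inv (h𝓑 : 𝓑 ⊆ closedConvexBodies n) (h𝓛 : 𝓛 ⊆ closedConvexBodies n)
    {μ : ℝ} (hμ : 0 < μ)
    (h : ∀ L ∈ familyAt 𝓛 f, ∃ B ∈ 𝓑, μ • L + {(1 - μ) • f} ⊆ B) :
    ApproximatesWithin f 𝓑 𝓛 μ⁻¹ := by
  intro k _ R s hs
  rw [one_div, inv_inv]
  have h0 : ∀ i, 0 ≤ μ⁻¹ * s i := fun i => mul_nonneg (inv_pos.2 hμ).le (hs.1 i)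
  refine ⟨fun i => μ⁻¹ * s i, ⟨h0, fun L hL => ⟨h0, fun hfL => ?_⟩⟩, ?_⟩
  · obtain ⟨B, hB, hsub⟩ := h L ⟨hL, hfL⟩
    have hsub' : ∀ x, f + x ∈ L → f + μ • x ∈ B := by
      intro x hx
      have e : f + μ • x = μ • (f + x) + (1 - μ) • f := by module
      rw [e]
      exact hsub (add_mem_add (smul_mem_smul_set hx) (mem_singleton _))
    have hfB : f ∈ interior B := by
      have hev : ∀ᶠ y in 𝓝 f, f + μ⁻¹ • (y - f) ∈ L := by
        have hc : Continuous fun y : E n => f + μ⁻¹ • (y - f) := by fun_prop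
        have := hc.tendsto f
        simp only [sub_self, smul_zero, add_zero] at this
        exact this (mem_interior_iff_mem_nhds.1 hfL)
      rw [mem_interior_iff_mem_nhds]
      filter_upwards [hev] with y hy
      have := hsub' _ hy
      rwa [smul_inv_smul₀ hμ.ne', add_sub_cancel] at this
    have hLs := isSublinear_gaugeAt (h𝓛 hL).2.1 hfL
    have hBs := isSublinear_gaugeAt (h𝓑 hB).2.1 hfB
    have hle : ∀ x, gaugeAt f B x ≤ μ⁻¹ * gaugeAt f L x := by
      intro x
      rw [le_inv_mul_iff₀ hμ]
      refine le_of_forall_pos_le_add fun ε hε => ?_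
      have hpos : 0 < gaugeAt f L x + ε := add_pos_of_nonneg_of_pos (hLs.nonneg x) hε
      have h1 : gaugeAt f L ((gaugeAt f L x + ε)⁻¹ • x) < 1 := by
        rw [hLs.smul _ _ (inv_pos.2 hpos).le, inv_mul_lt_iff₀ hpos]
        linarith
      have h2 := gaugeAt_le_one (hsub' _ (add_mem_of_gaugeAt_lt_one (h𝓛 hL).2.1 hfL h1))
      rw [hBs.smul _ _ hμ.le, hBs.smul _ _ (inv_pos.2 hpos).le, mul_left_comm,
        inv_mul_le_iff₀ hpos, mul_one] at h2
      exact h2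
    refine ((hs.2 B hB).2 hfB).trans (Finset.sum_le_sum fun i _ => ?_)
    have := mul_le_mul_of_nonneg_left (hle (R i)) (hs.1 i)
    linarith
  · ext i
    simp [hμ.ne']

theorem rhoAt_le_of_superset (h𝓑 : 𝓑 ⊆ closedConvexBodies n) (h𝓛 : 𝓛 ⊆ closedConvexBodies n)
    {μ : ℝ} (hμ : 0 < μ)
    (h : ∀ L ∈ familyAt 𝓛 f, ∃ B ∈ 𝓑, μ • L + {(1 - μ) • f} ⊆ B) :
    rhoAt f 𝓑 𝓛 ≤ ENNReal.ofReal μ⁻¹ :=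
  sInf_le ⟨μ⁻¹, inv_pos.2 hμ, approximatesWithin_inv h𝓑 h𝓛 hμ h, rfl⟩

theorem exists_superset_of_rhoAt_lt (h𝓑 : 𝓑 ⊆ closedConvexBodies n)
    (h𝓛 : 𝓛 ⊆ closedConvexBodies n) (hpoly : ∀ L ∈ 𝓛, IsPolyhedron L) {m : ℕ}
    (hm : ∀ L ∈ 𝓛, {F | IsFacet L F}.encard ≤ m) (hclosed : IsFClosed f 𝓑) {A : ℝ}
    (hrho : rhoAt f 𝓑 𝓛 < ENNReal.ofReal A) :
    ∀ L ∈ familyAt 𝓛 f, ∃ B ∈ 𝓑, (2 * A * (2 ^ m + 1) + 1)⁻¹ • L +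
      {(1 - (2 * A * (2 ^ m + 1) + 1)⁻¹) • f} ⊆ B := by
  intro L hL
  obtain ⟨_, ⟨α, hα, happ, rfl⟩, hlt⟩ := sInf_lt_iff.1 hrho
  have hαA : α < A := (ENNReal.ofReal_lt_ofReal_iff_of_nonneg hα.le).1 hlt
  have hA : 0 < A := hα.trans hαA
  obtain ⟨B, hB, hle⟩ := happ.exists_gaugeAt_le hα h𝓑 hclosed hL (h𝓛 hL.1) (hpoly L hL.1)
    (hm L hL.1)
  refine ⟨B, hB.1, ?_⟩
  -- The extra `1` makes the scaled gauge strictly less than `1`, which yields membership in `B` by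
  -- convexity.
  have hcpos : 0 < 2 * A * (2 ^ m + 1) + 1 := by positivity
  set μ := (2 * A * (2 ^ m + 1) + 1)⁻¹
  have hμ : 0 < μ := inv_pos.2 hcpos
  rintro _ ⟨_, ⟨x, hx, rfl⟩, _, rfl, rfl⟩
  have e : μ • x + (1 - μ) • f = f + μ • (x - f) := by module
  change μ • x + (1 - μ) • f ∈ B
  rw [e]
  refine add_mem_of_gaugeAt_lt_one (h𝓑 hB.1).2.1 hB.2 ?_
  rw [(isSublinear_gaugeAt (h𝓑 hB.1).2.1 hB.2).smul _ _ hμ.le, inv_mul_lt_iff₀ hcpos]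
  have h1 := hle (x - f) (by rwa [add_sub_cancel])
  have h2 : 2 * α * (2 ^ m + 1) ≤ 2 * A * (2 ^ m + 1) := by gcongr
  linarith

theorem rhoAt_le_rho (hf : f ∈ (intLattice n)ᶜ) : rhoAt f 𝓑 𝓛 ≤ rho 𝓑 𝓛 :=
  le_iSup₂ (f := fun f (_ : f ∈ (intLattice n)ᶜ) => rhoAt f 𝓑 𝓛) f hf

theorem lt_ofReal_toReal_add_one {a : ℝ≥0∞} (ha : a < ⊤) :
    a < ENNReal.ofReal (a.toReal + 1) := by
  rw [ENNReal.lt_ofReal_iff_toReal_lt ha.ne]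
  linarith

theorem inv_two_mul_add_one_mem_Ioo {a : ℝ≥0∞} (m : ℕ) :
    (2 * (a.toReal + 1) * (2 ^ m + 1) + 1)⁻¹ ∈ Ioo (0 : ℝ) 1 := by
  have h : 0 < 2 * (a.toReal + 1) * (2 ^ m + 1) := by positivity
  exact ⟨by positivity, inv_lt_one_of_one_lt₀ (by linarith)⟩

end Approximation

end OneForAll

open OneForAll
theorem theorem2p3 (n : ℕ) (𝓑 𝓛 : Set (Set (E n)))
    (h𝓑 : 𝓑 ⊆ closedConvexBodies n)
    (h𝓛 : 𝓛 ⊆ closedConvexBodies n)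
    (hpoly : ∀ L ∈ 𝓛, IsPolyhedron L)
    (hfacets : ∃ m : ℕ, ∀ L ∈ 𝓛, {F | IsFacet L F}.encard ≤ m) :
    (∀ f ∈ (intLattice n)ᶜ, IsFClosed f 𝓑 →
      (rhoAt f 𝓑 𝓛 < ⊤ ↔
        ∃ μ ∈ Ioo (0 : ℝ) 1, ∀ L ∈ familyAt 𝓛 f, ∃ B ∈ 𝓑,
          μ • L + {(1 - μ) • f} ⊆ B)) ∧
    ((∀ f ∈ (intLattice n)ᶜ, IsFClosed f 𝓑) →
      (rho 𝓑 𝓛 < ⊤ ↔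
        ∃ μ ∈ Ioo (0 : ℝ) 1, ∀ f ∈ (intLattice n)ᶜ, ∀ L ∈ familyAt 𝓛 f, ∃ B ∈ 𝓑,
          μ • L + {(1 - μ) • f} ⊆ B)) := by
  obtain ⟨m, hm⟩ := hfacets
  refine ⟨fun f _ hclosed => ⟨fun h => ?_, ?_⟩, fun hclosed => ⟨fun h => ?_, ?_⟩⟩
  · exact ⟨_, inv_two_mul_add_one_mem_Ioo m, exists_superset_of_rhoAt_lt h𝓑 h𝓛 hpoly hm hclosed
      (lt_ofReal_toReal_add_one h)⟩
  · rintro ⟨μ, hμ, h⟩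
    exact (rhoAt_le_of_superset h𝓑 h𝓛 hμ.1 h).trans_lt ENNReal.ofReal_lt_top
  -- The supremum `ρ` replaces `ρ_f`, so the same `μ` serves every `f`.
  · exact ⟨_, inv_two_mul_add_one_mem_Ioo m, fun f hf =>
      exists_superset_of_rhoAt_lt h𝓑 h𝓛 hpoly hm (hclosed f hf)
        ((rhoAt_le_rho hf).trans_lt (lt_ofReal_toReal_add_one h))⟩
  · rintro ⟨μ, hμ, h⟩
    exact (iSup₂_le fun f hf => rhoAt_le_of_superset h𝓑 h𝓛 hμ.1 (h f hf)).trans_lt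
      ENNReal.ofReal_lt_top
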